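/- **Theorem (uniqueness of the very weak solution, $g\equiv 1$).** Let $d\in\mathbb N$, $s>0$, $T>0$. For $v\in L^2(\mathbb R^d)$ let $\widehat v(\xi)=\int e^{-ix\cdot\xi}v(x)\,dx$ (extended to $L^2$), $(-\Delta)^{r}v=\mathcal F^{-1}(|\xi|^{2r}\widehat v)$, and let $H^s(\mathbb R^d)$ be the space of $v\in L^2(\mathbb R^d)$ with $\|v\|_{H^s}^2=(2\pi)^{-d}\int(1+|\xi|^{2s})|\widehat v(\xi)|^2d\xi<\infty$. A net $(a_\varepsilon)_{\varepsilon\in(0,1]}$ in a normed space $X$ is called $X$-moderate if there are $N\in\mathbb N$ and $C$ with $\|a_\varepsilon\|_X\le C\varepsilon^{-N}$ for all $\varepsilon\in(0,1]$, and $X$-negligible if for every $k\in\mathbb N$ there is $C$ with $\|a_\varepsilon\|_X\le C\varepsilon^{k}$ for all $\varepsilon\in(0,1]$. For nets of functions of $t\in[0,T]$ these bounds are required uniformly in $t\in[0,T]$ (that is, $C$ and $N$ do not depend on $t$). Let $(m_\varepsilon),(b_\varepsilon),(f_\varepsilon),(u_{0,\varepsilon}),(u_{1,\varepsilon})$ and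 $(\tilde m_\varepsilon),(\tilde b_\varepsilon),(\tilde f_\varepsilon),(\tilde u_{0,\varepsilon}),(\tilde u_{1,\varepsilon})$, $\varepsilon\in(0,1]$, be two families of nets, for example two families of regularisations of the same coefficients $m,b$, source term $f$ and Cauchy data $u_0,u_1$ (no relation other than the following ones is needed). Assume for both families that * $m_\varepsilon,b_\varepsilon\in L^\infty(\mathbb R^d)$ are real-valued and non-negative, $f_\varepsilon\in C([0,T];L^2(\mathbb R^d))$, $u_{0,\varepsilon}\in H^s(\mathbb R^d)$, $u_{1,\varepsilon}\in L^2(\mathbb R^d)$, and these nets are $L^\infty$-, $L^\infty$-, $L^2$-, $H^s$- and $L^2$-moderate, respectively; and that the nets $(m_\varepsilon-\tilde m_\varepsilon)$, $(b_\varepsilon-\tilde b_\varepsilon)$, $(f_\varepsilon-\tilde f_\varepsilon)$, $(u_{0,\varepsilon}-\tilde u_{0,\varepsilon})$, $(u_{1,\varepsilon}-\tilde u_{1,\varepsilon})$ are $L^\infty$-, $L^\infty$-, $L^2$-, $H^s$- and $L^2$-negligible, respectively. For every $\varepsilon\in(0,1]$ let $u_\varepsilon\in C([0,T];H^s(\mathbb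 R^d))\cap C^1([0,T];L^2(\mathbb R^d))$ be a solution of $$\partial_t^2u_\varepsilon+(-\Delta)^su_\varepsilon+m_\varepsilon u_\varepsilon+b_\varepsilon\partial_tu_\varepsilon=f_\varepsilon\ \text{ on }[0,T]\times\mathbb R^d,\qquad u_\varepsilon(0)=u_{0,\varepsilon},\quad \partial_tu_\varepsilon(0)=u_{1,\varepsilon},$$ in the sense that for all $\varphi\in H^s(\mathbb R^d)$ and all $t\in[0,T]$ $$\tfrac{d}{dt}\langle \partial_tu_\varepsilon,\varphi\rangle_{L^2}+\langle(-\Delta)^{s/2}u_\varepsilon,(-\Delta)^{s/2}\varphi\rangle_{L^2}+\langle m_\varepsilon u_\varepsilon,\varphi\rangle_{L^2}+\langle b_\varepsilon\partial_tu_\varepsilon,\varphi\rangle_{L^2}=\langle f_\varepsilon,\varphi\rangle_{L^2},$$ and let $\tilde u_\varepsilon$ be, in the same sense, a solution of the problem with $\tilde m_\varepsilon,\tilde b_\varepsilon,\tilde f_\varepsilon,\tilde u_{0,\varepsilon},\tilde u_{1,\varepsilon}$. Then $(u_\varepsilon-\tilde u_\varepsilon)_\varepsilon$ is $L^2$-negligible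 uniformly in $t\in[0,T]$: for every $k\in\mathbb N$ there is $C$ such that $\|u_\varepsilon(t,\cdot)-\tilde u_\varepsilon(t,\cdot)\|_{L^2}\le C\varepsilon^k$ for all $\varepsilon\in(0,1]$ and all $t\in[0,T]$. In particular $(u_\varepsilon(t,\cdot)-\tilde u_\varepsilon(t,\cdot))_\varepsilon$ is $L^2$-negligible for every $t\in[0,T]$. -/

import Mathlib

open MeasureTheory Set Filter Topology
open scoped FourierTransform ENNReal

noncomputable section

namespace VeryWeak

/-- The space `L²(ℝᵈ)` of (classes of) complex-valued functions. -/
abbrev L2 (d : ℕ) : Type :=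
  Lp ℂ 2 (volume : Measure (EuclideanSpace ℝ (Fin d)))

/-- The space `L^∞(ℝᵈ)` of (classes of) real-valued functions. -/
abbrev LInf (d : ℕ) : Type :=
  Lp ℝ ∞ (volume : Measure (EuclideanSpace ℝ (Fin d)))

/-- `v ∈ Hˢ(ℝᵈ)`: `v ∈ L²` and `∫ (1 + |ξ|^{2s}) |v̂(ξ)|² dξ < ∞`. The Fourier transform `𝓕` has
the kernel `exp (-2πi⟨x, ξ⟩)`, so that the frequency `|ξ|` of the kernel `exp (-i⟨x, ξ⟩)` reads
`2π|ξ|` here. -/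
def MemHs {d : ℕ} (s : ℝ) (v : L2 d) : Prop :=
  Integrable (fun ξ : EuclideanSpace ℝ (Fin d) =>
    (1 + (2 * Real.pi * ‖ξ‖) ^ (2 * s)) * ‖(𝓕 v : L2 d) ξ‖ ^ 2)

/-- The norm `(∫ (1 + |ξ|^{2s}) |v̂(ξ)|² dξ)^{1/2}` of `Hˢ(ℝᵈ)`, meaningful when `MemHs s v`. -/
def hsNorm {d : ℕ} (s : ℝ) (v : L2 d) : ℝ :=
  Real.sqrt (∫ ξ : EuclideanSpace ℝ (Fin d),
    (1 + (2 * Real.pi * ‖ξ‖) ^ (2 * s)) * ‖(𝓕 v : L2 d) ξ‖ ^ 2)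

open Classical in
/-- The fractional Laplacian `(-Δ)^r v = 𝓕⁻¹ (|ξ|^{2r} v̂)` as an operator in `L²(ℝᵈ)`, with
domain the `v` for which `|ξ|^{2r} v̂ ∈ L²` (this is `H^{2r}` for `r > 0`); its value is `0`
outside of the domain. -/
def fracLaplacian {d : ℕ} (r : ℝ) (v : L2 d) : L2 d :=
  if h : MemLp (fun ξ : EuclideanSpace ℝ (Fin d) =>
      (2 * Real.pi * ‖ξ‖) ^ (2 * r) • (𝓕 v : L2 d) ξ) 2 volume
  then 𝓕⁻ (h.toLp : L2 d) else 0

/-- `u ∈ C([0,T]; Hˢ(ℝᵈ))`. -/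
def ContinuousHs {d : ℕ} (T s : ℝ) (u : ℝ → L2 d) : Prop :=
  (∀ t ∈ Icc 0 T, MemHs s (u t)) ∧
    ∀ t₀ ∈ Icc 0 T, Tendsto (fun t => hsNorm s (u t - u t₀)) (𝓝[Icc 0 T] t₀) (𝓝 0)

/-- The time derivative on `[0,T]` (one-sided at the end points). -/
def dt {d : ℕ} (T : ℝ) (u : ℝ → L2 d) (t : ℝ) : L2 d :=
  derivWithin u (Icc 0 T) t

/-- `u ∈ C([0,T]; Hˢ) ∩ C¹([0,T]; L²)` is a solution of the Cauchy problem
`u_tt + (-Δ)ˢ u + m u + b u_t = f` on `[0,T] × ℝᵈ`, `u(0) = u₀`, `u_t(0) = u₁`.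
As `u_tt` and `(-Δ)ˢ u` take values in the dual of `Hˢ`, the equation is tested against
`φ ∈ Hˢ`: for all `t ∈ [0,T]`,
`d/dt ⟨u_t, φ⟩ + ⟨(-Δ)^{s/2} u, (-Δ)^{s/2} φ⟩ + ⟨m u, φ⟩ + ⟨b u_t, φ⟩ = ⟨f, φ⟩`.
Mathlib's inner product is linear in its second argument. -/
structure IsSolution {d : ℕ} (T s : ℝ) (m b : LInf d) (f : ℝ → L2 d) (u₀ u₁ : L2 d)
    (u : ℝ → L2 d) : Prop where
  continuousHs : ContinuousHs T s u
  contDiffOn : ContDiffOn ℝ 1 u (Icc 0 T)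
  init : u 0 = u₀
  init_dt : dt T u 0 = u₁
  equation : ∀ φ : L2 d, MemHs s φ → ∀ t ∈ Icc 0 T,
    HasDerivWithinAt (fun τ => inner ℂ φ (dt T u τ))
      (inner ℂ φ (f t)
        - inner ℂ (fracLaplacian (s / 2) φ) (fracLaplacian (s / 2) (u t))
        - inner ℂ φ (m • u t : L2 d)
        - inner ℂ φ (b • dt T u t : L2 d))
      (Icc 0 T) t

/-- A net of norms `(r_ε)_{ε ∈ (0,1]}` is moderate: `r_ε ≲ ε^{-N}` for some `N`. -/
def IsModerate (r : ℝ → ℝ) : Prop :=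
  ∃ (N : ℕ) (C : ℝ), ∀ ε ∈ Ioc (0 : ℝ) 1, r ε ≤ C * (ε ^ N)⁻¹

/-- A net of norms `(r_ε)_{ε ∈ (0,1]}` is negligible: `r_ε ≲ ε^k` for all `k`. -/
def IsNegligible (r : ℝ → ℝ) : Prop :=
  ∀ k : ℕ, ∃ C : ℝ, ∀ ε ∈ Ioc (0 : ℝ) 1, r ε ≤ C * ε ^ k

/-- Moderateness of a time-dependent net, uniformly in `t ∈ [0,T]`. -/
def IsModerateUnif (T : ℝ) (r : ℝ → ℝ → ℝ) : Prop :=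
  ∃ (N : ℕ) (C : ℝ), ∀ ε ∈ Ioc (0 : ℝ) 1, ∀ t ∈ Icc 0 T, r ε t ≤ C * (ε ^ N)⁻¹

/-- Negligibility of a time-dependent net, uniformly in `t ∈ [0,T]`. -/
def IsNegligibleUnif (T : ℝ) (r : ℝ → ℝ → ℝ) : Prop :=
  ∀ k : ℕ, ∃ C : ℝ, ∀ ε ∈ Ioc (0 : ℝ) 1, ∀ t ∈ Icc 0 T, r ε t ≤ C * ε ^ k

/-- Families `(m_ε), (b_ε), (f_ε), (u_{0,ε}), (u_{1,ε})` of regularised coefficients, source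
terms and Cauchy data. Only the values at `ε ∈ (0,1]` and at times `t ∈ [0,T]` are relevant. -/
structure RegFamily (d : ℕ) where
  m : ℝ → LInf d
  b : ℝ → LInf d
  f : ℝ → ℝ → L2 d
  u₀ : ℝ → L2 d
  u₁ : ℝ → L2 d

/-- The families are `{L^∞, L^∞, L², Hˢ, L²}`-moderate, with `m_ε, b_ε ≥ 0` and
`f_ε ∈ C([0,T]; L²)`. -/
structure RegFamily.Admissible {d : ℕ} (T s : ℝ) (R : RegFamily d) : Prop where
  m_nonneg : ∀ ε ∈ Ioc (0 : ℝ) 1, ∀ᵐ x, 0 ≤ R.m ε x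
  b_nonneg : ∀ ε ∈ Ioc (0 : ℝ) 1, ∀ᵐ x, 0 ≤ R.b ε x
  f_cont : ∀ ε ∈ Ioc (0 : ℝ) 1, ContinuousOn (R.f ε) (Icc 0 T)
  u₀_mem : ∀ ε ∈ Ioc (0 : ℝ) 1, MemHs s (R.u₀ ε)
  m_moderate : IsModerate (fun ε => ‖R.m ε‖)
  b_moderate : IsModerate (fun ε => ‖R.b ε‖)
  f_moderate : IsModerateUnif T (fun ε t => ‖R.f ε t‖)
  u₀_moderate : IsModerate (fun ε => hsNorm s (R.u₀ ε))
  u₁_moderate : IsModerate (fun ε => ‖R.u₁ ε‖)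

/-- The differences of two families are `{L^∞, L^∞, L², Hˢ, L²}`-negligible. -/
structure RegFamily.NegligibleDiff {d : ℕ} (T s : ℝ) (R R' : RegFamily d) : Prop where
  m : IsNegligible (fun ε => ‖R.m ε - R'.m ε‖)
  b : IsNegligible (fun ε => ‖R.b ε - R'.b ε‖)
  f : IsNegligibleUnif T (fun ε t => ‖R.f ε t - R'.f ε t‖)
  u₀ : IsNegligible (fun ε => hsNorm s (R.u₀ ε - R'.u₀ ε))
  u₁ : IsNegligible (fun ε => ‖R.u₁ ε - R'.u₁ ε‖)

/-- `(u_ε)_{ε ∈ (0,1]}` is the family of solutions to the regularised Cauchy problems. -/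
def RegFamily.SolvedBy {d : ℕ} (T s : ℝ) (R : RegFamily d) (u : ℝ → ℝ → L2 d) : Prop :=
  ∀ ε ∈ Ioc (0 : ℝ) 1, IsSolution T s (R.m ε) (R.b ε) (R.f ε) (R.u₀ ε) (R.u₁ ε) (u ε)

end VeryWeak

end

/-!
The difference `w = u - u'` of the two solutions solves, for each `ε`, the equation with the
coefficients `m`, `b` of the first problem and the source
`F = (f - f') - (m - m') u' - (b - b') ∂ₜu'`. The claim follows from an a priori estimate which
depends only polynomially on the norms of the data and coefficients
(`IsTruncatedSolution.bounds`): applied to `u'` it shows that `u'` and `∂ₜu'` are moderate, hence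
`F` is negligible; applied to `w` it shows that `w` is negligible. A Grönwall argument in which `m` and
`b` are treated as perturbations would lose a factor `exp (T ‖m‖)`, which is not moderate.

The estimate is the energy inequality for
`E = ‖∂ₜw‖² + ‖(-Δ)^{s/2} w‖² + ⟪w, m w⟫`, whose derivative is formally
`2 Re ⟪∂ₜw, F⟫ - 2 ⟪∂ₜw, b ∂ₜw⟫ ≤ 2 ‖∂ₜw‖ ‖F‖`. As `∂ₜ²w` is only a functional on `Hˢ`, the equation
cannot be tested against `∂ₜw`. It is therefore truncated to the frequencies `‖ξ‖ ≤ n`: there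
`(-Δ)ˢ` is bounded, the truncation of `∂ₜw` is continuously differentiable in `L²`
(`hasDerivAt_of_weak`), and the energy identity holds
(`IsTruncatedSolution.energy_eq`). Only an upper bound for the initial energy is needed in the limit
`n → ∞` (`IsTruncatedSolution.energy_le`). The maximum `S` of `‖∂ₜw‖` then satisfies a quadratic
inequality `S² ≤ E(0) + 2 T S sup ‖F‖`, which bounds `S`, and `‖w‖` is bounded by integration.
The argument up to this point is carried out in an abstract Hilbert space, with pairs of bounded
operators `P n`, `A n` in place of the truncations of the identity and of `(-Δ)^{s/2}`.
-/

noncomputable section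

namespace VeryWeak

/-! ### The energy estimate in a Hilbert space -/

section Hilbert

variable {H : Type*} [NormedAddCommGroup H] [InnerProductSpace ℂ H]

theorem hasDerivAt_re_inner {x y : ℝ → H} {x' y' : H} {t : ℝ} (hx : HasDerivAt x x' t)
    (hy : HasDerivAt y y' t) :
    HasDerivAt (fun τ => (inner ℂ (x τ) (y τ)).re)
      ((inner ℂ (x t) y').re + (inner ℂ x' (y t)).re) t := by
  exact (Complex.reCLM.hasFDerivAt.comp_hasDerivAt t (hx.inner ℂ hy)).congr_deriv (by simp)

theorem re_inner_self_eq (x : H) : (inner ℂ x x).re = ‖x‖ ^ 2 := by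
  have := inner_self_eq_norm_sq (𝕜 := ℂ) x
  simpa using this

theorem re_inner_le (x y : H) : (inner ℂ x y).re ≤ ‖x‖ * ‖y‖ := by
  simpa using re_inner_le_norm (𝕜 := ℂ) x y

/-- Abstract form of the truncation to bounded frequencies: `P n` stands for the truncation
itself, and `A n` for the bounded operator `(-Δ)^{s/2} (P n)`. -/
structure IsTruncation (P A : ℕ → H →L[ℂ] H) : Prop where
  symm_fst : ∀ n x y, inner ℂ (P n x) y = inner ℂ x (P n y)
  symm_snd : ∀ n x y, inner ℂ (A n x) y = inner ℂ x (A n y)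
  fst_fst : ∀ n x, P n (P n x) = P n x
  snd_fst : ∀ n x, A n (P n x) = A n x
  norm_le : ∀ n x, ‖P n x‖ ≤ ‖x‖
  tendsto : ∀ x, Tendsto (fun n => P n x) atTop (𝓝 x)

/-- `w` solves `w'' + Λ²w + M w + B w' = f` on `(0, T)`, where `v = w'` and `A n` is the truncation
`Λ (P n)` of the possibly unbounded operator `Λ`: the equation holds weakly after applying each
`P n`, so that only bounded operators occur. -/
structure IsTruncatedSolution (T : ℝ) (P A : ℕ → H →L[ℂ] H) (M B : H →L[ℂ] H)
    (f w v : ℝ → H) : Prop where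
  contf : ContinuousOn f (Icc 0 T)
  contw : ContinuousOn w (Icc 0 T)
  contv : ContinuousOn v (Icc 0 T)
  deriv : ∀ t ∈ Ioo 0 T, HasDerivAt w (v t) t
  eqn : ∀ n φ, ∀ t ∈ Ioo 0 T, HasDerivAt (fun τ => inner ℂ φ (P n (v τ)))
    (inner ℂ φ (P n (f t - M (w t) - B (v t)) - A n (A n (w t)))) t

variable {T : ℝ} {P A : ℕ → H →L[ℂ] H} {M B M' B' : H →L[ℂ] H} {f w v f' w' v' : ℝ → H}

/-- The difference of two solutions with different coefficients solves the equation with the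
coefficients of the first one; the differences of the coefficients, applied to the second
solution, become part of the source. -/
theorem IsTruncatedSolution.sub (h : IsTruncatedSolution T P A M B f w v)
    (h' : IsTruncatedSolution T P A M' B' f' w' v') :
    IsTruncatedSolution T P A M B
      (fun t => f t - f' t - (M - M') (w' t) - (B - B') (v' t))
      (fun t => w t - w' t) (fun t => v t - v' t) where
  contf := ((h.contf.sub h'.contf).sub ((M - M').continuous.comp_continuousOn h'.contw)).sub
    ((B - B').continuous.comp_continuousOn h'.contv)
  contw := h.contw.sub h'.contw
  contv := h.contv.sub h'.contv
  deriv t ht := (h.deriv t ht).sub (h'.deriv t ht)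
  eqn n φ t ht := by
    have hd := (h.eqn n φ t ht).sub (h'.eqn n φ t ht)
    refine (hd.congr_deriv ?_).congr_of_eventuallyEq (Eventually.of_forall fun τ => ?_)
    · rw [← inner_sub_right]
      congr 1
      simp only [map_sub, sub_apply]
      abel
    · simp

variable [CompleteSpace H]

/-- A continuous curve whose weak derivative is continuous is strongly differentiable: by the
fundamental theorem of calculus for each `⟪φ, v⟫` it is a primitive of its weak derivative. -/
theorem hasDerivAt_of_weak {v g : ℝ → H} (hv : ContinuousOn v (Icc 0 T))
    (hg : ContinuousOn g (Icc 0 T))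
    (hweak : ∀ φ : H, ∀ t ∈ Ioo 0 T,
      HasDerivAt (fun τ => inner ℂ φ (v τ)) (inner ℂ φ (g t)) t) :
    ∀ t ∈ Ioo 0 T, HasDerivAt v (g t) t := by
  intro t ht
  have hint : ∀ τ ∈ Icc 0 T, IntervalIntegrable g volume 0 τ := fun τ hτ =>
    (hg.mono (by rw [uIcc_of_le hτ.1]; exact Icc_subset_Icc_right hτ.2)).intervalIntegrable
  have key : ∀ τ ∈ Icc 0 T, v τ = v 0 + ∫ σ in (0 : ℝ)..τ, g σ := by
    intro τ hτ
    rw [← sub_eq_iff_eq_add']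
    refine ext_inner_left ℂ fun φ => ?_
    have hsub : Icc 0 τ ⊆ Icc 0 T := Icc_subset_Icc_right hτ.2
    have h := intervalIntegral.integral_eq_sub_of_hasDerivAt_of_le hτ.1
      (f := fun σ => inner ℂ φ (v σ)) (f' := fun σ => inner ℂ φ (g σ))
      (continuousOn_const.inner (hv.mono hsub))
      (fun σ hσ => hweak φ σ ⟨hσ.1, hσ.2.trans_le hτ.2⟩)
      (ContinuousOn.intervalIntegrable
        (by rw [uIcc_of_le hτ.1]; exact continuousOn_const.inner (hg.mono hsub)))
    rw [inner_sub_right, ← h]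
    exact ContinuousLinearMap.intervalIntegral_comp_comm (innerSL ℂ φ) (hint τ hτ)
  have hIcc : Icc 0 T ∈ 𝓝 t := Icc_mem_nhds ht.1 ht.2
  have htI : t ∈ Icc 0 T := Ioo_subset_Icc_self ht
  have hd : HasDerivAt (fun τ => v 0 + ∫ σ in (0 : ℝ)..τ, g σ) (g t) t :=
    (intervalIntegral.integral_hasDerivAt_right (hint t htI)
      (ContinuousOn.stronglyMeasurableAtFilter isOpen_Ioo (hg.mono Ioo_subset_Icc_self) t ht)
      (hg.continuousAt hIcc)).const_add _
  exact hd.congr_of_eventuallyEq (by filter_upwards [hIcc] with τ hτ using key τ hτ)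

/-- The energy identity of the truncated solution. The terms that contain `A n` cancel. The
potential energy `⟪w, M w⟫` is not truncated: `M` is bounded, and `w` is differentiable in `H`, so
its derivative is available directly. -/
theorem IsTruncatedSolution.energy_eq (hPA : IsTruncation P A)
    (hM : ∀ x y, inner ℂ (M x) y = inner ℂ x (M y))
    (h : IsTruncatedSolution T P A M B f w v) (n : ℕ) {t : ℝ} (ht : t ∈ Icc 0 T) :
    ‖P n (v t)‖ ^ 2 + ‖A n (w t)‖ ^ 2 + (inner ℂ (w t) (M (w t))).re =
      ‖P n (v 0)‖ ^ 2 + ‖A n (w 0)‖ ^ 2 + (inner ℂ (w 0) (M (w 0))).re +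
      ∫ τ in (0 : ℝ)..t, (2 * (inner ℂ (v τ) (P n (f τ - M (w τ) - B (v τ)))).re
        + 2 * (inner ℂ (v τ) (M (w τ))).re) := by
  have hsub : Icc 0 t ⊆ Icc 0 T := Icc_subset_Icc_right ht.2
  have hf := h.contf
  have hw := h.contw
  have hv := h.contv
  have hstrong := hasDerivAt_of_weak (T := T) (v := fun τ => P n (v τ))
    (g := fun τ => P n (f τ - M (w τ) - B (v τ)) - A n (A n (w τ)))
    (by fun_prop) (by fun_prop) (h.eqn n)
  have hE := intervalIntegral.integral_eq_sub_of_hasDerivAt_of_le ht.1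
    (f := fun τ => (inner ℂ (P n (v τ)) (P n (v τ))).re + (inner ℂ (A n (w τ)) (A n (w τ))).re
      + (inner ℂ (w τ) (M (w τ))).re)
    (f' := fun τ => (2 * (inner ℂ (v τ) (P n (f τ - M (w τ) - B (v τ)))).re
        + 2 * (inner ℂ (v τ) (M (w τ))).re))
    (by
      refine ContinuousOn.mono ?_ hsub
      refine ((Complex.continuous_re.comp_continuousOn ?_).add
        (Complex.continuous_re.comp_continuousOn ?_)).add
        (Complex.continuous_re.comp_continuousOn ?_) <;>
      exact ContinuousOn.inner (by fun_prop) (by fun_prop))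
    (by
      intro τ hτ
      have hτ' : τ ∈ Ioo 0 T := ⟨hτ.1, hτ.2.trans_le ht.2⟩
      have d1 := hstrong τ hτ'
      have d2 := h.deriv τ hτ'
      have d3 : HasDerivAt (fun τ => A n (w τ)) (A n (v τ)) τ :=
        ((A n).restrictScalars ℝ).hasFDerivAt.comp_hasDerivAt τ d2
      have d4 : HasDerivAt (fun τ => M (w τ)) (M (v τ)) τ :=
        (M.restrictScalars ℝ).hasFDerivAt.comp_hasDerivAt τ d2
      have hd := ((hasDerivAt_re_inner d1 d1).add (hasDerivAt_re_inner d3 d3)).add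
        (hasDerivAt_re_inner d2 d4)
      refine hd.congr_deriv ?_
      have sym : ∀ x y : H, (inner ℂ x y).re = (inner ℂ y x).re := fun x y => by
        simpa using inner_re_symm (𝕜 := ℂ) x y
      rw [sym (P n (f τ - M (w τ) - B (v τ)) - A n (A n (w τ))), inner_sub_right, Complex.sub_re,
        hPA.symm_fst, hPA.fst_fst, ← hPA.symm_snd, hPA.snd_fst, sym (A n (w τ)),
        ← hM, sym (M (w τ))]
      ring)
    (by
      refine ContinuousOn.intervalIntegrable ?_
      rw [uIcc_of_le ht.1]
      refine ContinuousOn.mono ?_ hsub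
      refine ContinuousOn.add (continuousOn_const.mul (Complex.continuous_re.comp_continuousOn ?_))
        (continuousOn_const.mul (Complex.continuous_re.comp_continuousOn ?_)) <;>
      exact ContinuousOn.inner (by fun_prop) (by fun_prop))
  simp only [re_inner_self_eq] at hE
  linarith

/-- The limit `n → ∞` of the energy identity, in which the potential term cancels and the damping
term has a favourable sign. The constants do not depend on the size of `M` and `B` except through
the initial energy, in contrast to a Grönwall argument. -/
theorem IsTruncatedSolution.energy_le (hPA : IsTruncation P A)
    (hM : ∀ x y, inner ℂ (M x) y = inner ℂ x (M y)) (hM0 : ∀ x, 0 ≤ (inner ℂ x (M x)).re)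
    (hB0 : ∀ x, 0 ≤ (inner ℂ x (B x)).re)
    (h : IsTruncatedSolution T P A M B f w v) {K : ℝ} (hK : ∀ n, ‖A n (w 0)‖ ≤ K)
    {t : ℝ} (ht : t ∈ Icc 0 T) :
    ‖v t‖ ^ 2 ≤ ‖v 0‖ ^ 2 + K ^ 2 + (inner ℂ (w 0) (M (w 0))).re
      + ∫ τ in (0 : ℝ)..t, 2 * (‖v τ‖ * ‖f τ‖) := by
  have hsub : Icc 0 t ⊆ Icc 0 T := Icc_subset_Icc_right ht.2
  have hf := h.contf.mono hsub
  have hw := h.contw.mono hsub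
  have hv := h.contv.mono hsub
  set G : ℝ → H := fun τ => f τ - M (w τ) - B (v τ) with hG
  have hGc : ContinuousOn G (Icc 0 t) := by fun_prop
  have hre : ∀ {x y : ℝ → H}, ContinuousOn x (Icc 0 t) → ContinuousOn y (Icc 0 t) →
      ContinuousOn (fun τ => (inner ℂ (x τ) (y τ)).re) (Icc 0 t) := fun hx hy =>
    Complex.continuous_re.comp_continuousOn (hx.inner hy)
  have hlim : Tendsto (fun n => ∫ τ in (0 : ℝ)..t, (2 * (inner ℂ (v τ) (P n (G τ))).re
        + 2 * (inner ℂ (v τ) (M (w τ))).re)) atTop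
      (𝓝 (∫ τ in (0 : ℝ)..t, (2 * (inner ℂ (v τ) (G τ)).re
        + 2 * (inner ℂ (v τ) (M (w τ))).re))) := by
    refine intervalIntegral.tendsto_integral_filter_of_dominated_convergence
      (fun τ => 2 * (‖v τ‖ * ‖G τ‖) + 2 * (‖v τ‖ * ‖M (w τ)‖)) ?_ ?_ ?_ ?_
    · refine Eventually.of_forall fun n => ?_
      rw [uIoc_of_le ht.1]
      refine ContinuousOn.aestronglyMeasurable ?_ measurableSet_Ioc
      exact ((continuousOn_const.mul (hre hv (by fun_prop))).add
        (continuousOn_const.mul (hre hv (by fun_prop)))).mono Ioc_subset_Icc_self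
    · refine Eventually.of_forall fun n => Eventually.of_forall fun τ _ => ?_
      rw [Real.norm_eq_abs]
      refine (abs_add_le _ _).trans ?_
      rw [abs_mul, abs_mul, abs_two]
      have e1 : |(inner ℂ (v τ) (P n (G τ))).re| ≤ ‖v τ‖ * ‖G τ‖ :=
        (Complex.abs_re_le_norm _).trans <| (norm_inner_le_norm _ _).trans <|
          mul_le_mul_of_nonneg_left (hPA.norm_le n _) (norm_nonneg _)
      have e2 : |(inner ℂ (v τ) (M (w τ))).re| ≤ ‖v τ‖ * ‖M (w τ)‖ :=
        (Complex.abs_re_le_norm _).trans (norm_inner_le_norm _ _)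
      linarith
    · refine ContinuousOn.intervalIntegrable ?_
      rw [uIcc_of_le ht.1]
      fun_prop
    · refine Eventually.of_forall fun τ _ => ?_
      refine Tendsto.add_const _ (Tendsto.const_mul _ ?_)
      exact (Complex.continuous_re.tendsto _).comp (tendsto_const_nhds.inner (hPA.tendsto _))
  have hlhs : Tendsto (fun n => ‖P n (v t)‖ ^ 2) atTop (𝓝 (‖v t‖ ^ 2)) :=
    (hPA.tendsto _).norm.pow 2
  have hle : ∀ n, ‖P n (v t)‖ ^ 2 ≤ ‖v 0‖ ^ 2 + K ^ 2 + (inner ℂ (w 0) (M (w 0))).re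
      + ∫ τ in (0 : ℝ)..t, (2 * (inner ℂ (v τ) (P n (G τ))).re
        + 2 * (inner ℂ (v τ) (M (w τ))).re) := by
    intro n
    have e := h.energy_eq hPA hM n ht
    have e1 : ‖P n (v 0)‖ ^ 2 ≤ ‖v 0‖ ^ 2 := by gcongr; exact hPA.norm_le n _
    have e2 : ‖A n (w 0)‖ ^ 2 ≤ K ^ 2 := by gcongr; exact hK n
    have e3 := hM0 (w t)
    have e4 := sq_nonneg ‖A n (w t)‖
    simp only [hG]
    linarith
  refine (le_of_tendsto_of_tendsto' hlhs (hlim.const_add _) hle).trans ?_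
  gcongr
  refine intervalIntegral.integral_mono_on ht.1 ?_ ?_ fun τ _ => ?_
  · refine ContinuousOn.intervalIntegrable ?_
    rw [uIcc_of_le ht.1]
    exact (continuousOn_const.mul (hre hv (by fun_prop))).add
      (continuousOn_const.mul (hre hv (by fun_prop)))
  · refine ContinuousOn.intervalIntegrable ?_
    rw [uIcc_of_le ht.1]
    fun_prop
  · have e1 := re_inner_le (v τ) (f τ)
    have e2 := hB0 (v τ)
    simp only [hG, inner_sub_right, Complex.sub_re]
    linarith

theorem IsTruncatedSolution.norm_deriv_le (hPA : IsTruncation P A)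
    (hM : ∀ x y, inner ℂ (M x) y = inner ℂ x (M y)) (hM0 : ∀ x, 0 ≤ (inner ℂ x (M x)).re)
    (hB0 : ∀ x, 0 ≤ (inner ℂ x (B x)).re)
    (h : IsTruncatedSolution T P A M B f w v) {K μ F : ℝ} (hK : ∀ n, ‖A n (w 0)‖ ≤ K)
    (hwK : ‖w 0‖ ≤ K) (hMμ : ∀ x, ‖M x‖ ≤ μ * ‖x‖) (hμ : 0 ≤ μ)
    (hF : ∀ t ∈ Icc 0 T, ‖f t‖ ≤ F) {t : ℝ} (ht : t ∈ Icc 0 T) :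
    ‖v t‖ ≤ ‖v 0‖ + (1 + μ) * K + 2 * T * F := by
  have hT : 0 ≤ T := ht.1.trans ht.2
  have hF0 : 0 ≤ F := (norm_nonneg _).trans (hF t ht)
  have hK0 : 0 ≤ K := (norm_nonneg _).trans hwK
  -- The maximal value of `‖v‖` is bounded through a quadratic inequality.
  obtain ⟨τ, hτ, hmax⟩ := isCompact_Icc.exists_isMaxOn ⟨t, ht⟩ h.contv.norm
  refine (hmax ht : ‖v t‖ ≤ ‖v τ‖).trans ?_
  have hE := h.energy_le hPA hM hM0 hB0 hK hτ
  have hI : ∫ σ in (0 : ℝ)..τ, 2 * (‖v σ‖ * ‖f σ‖) ≤ 2 * T * F * ‖v τ‖ := by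
    refine (Real.le_norm_self _).trans ((intervalIntegral.norm_integral_le_of_norm_le_const
      (C := 2 * (‖v τ‖ * F)) fun σ hσ => ?_).trans ?_)
    · rw [uIoc_of_le hτ.1] at hσ
      have hσ' : σ ∈ Icc 0 T := ⟨hσ.1.le, hσ.2.trans hτ.2⟩
      rw [Real.norm_of_nonneg (by positivity)]
      gcongr
      exacts [hmax hσ', hF σ hσ']
    · rw [sub_zero, abs_of_nonneg hτ.1]
      calc 2 * (‖v τ‖ * F) * τ ≤ 2 * (‖v τ‖ * F) * T := by gcongr; exact hτ.2
        _ = _ := by ring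
  have hQ : (inner ℂ (w 0) (M (w 0))).re ≤ μ * K ^ 2 := by
    calc _ ≤ ‖w 0‖ * ‖M (w 0)‖ := re_inner_le _ _
      _ ≤ K * (μ * K) := by
        gcongr
        exact (hMμ _).trans (by gcongr)
      _ = _ := by ring
  have hX : ‖v 0‖ ^ 2 + K ^ 2 + μ * K ^ 2 ≤ (‖v 0‖ + (1 + μ) * K) ^ 2 := by
    have : 0 ≤ ‖v 0‖ * ((1 + μ) * K) := by positivity
    have : 0 ≤ (1 + μ) * μ * K ^ 2 := by positivity
    nlinarith
  -- If `X` and `Y` denote the two summands below, then `S ^ 2 ≤ X ^ 2 + Y * S` for `S = ‖v τ‖`,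
  -- which excludes `S > X + Y`.
  by_contra! hlt
  have hX0 : 0 ≤ ‖v 0‖ + (1 + μ) * K := by positivity
  have hTF : 0 ≤ 2 * T * F := by positivity
  generalize ‖v 0‖ + (1 + μ) * K = X at *
  generalize 2 * T * F = Y at *
  nlinarith [norm_nonneg (v τ)]

theorem IsTruncatedSolution.norm_le (h : IsTruncatedSolution T P A M B f w v) {S : ℝ}
    (hS : ∀ t ∈ Icc 0 T, ‖v t‖ ≤ S) {t : ℝ} (ht : t ∈ Icc 0 T) :
    ‖w t‖ ≤ ‖w 0‖ + T * S := by
  have hS0 : 0 ≤ S := (norm_nonneg _).trans (hS t ht)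
  have hsub : Icc 0 t ⊆ Icc 0 T := Icc_subset_Icc_right ht.2
  have hv := h.contv.mono hsub
  have e := intervalIntegral.integral_eq_sub_of_hasDerivAt_of_le ht.1
    (h.contw.mono hsub) (fun τ hτ => h.deriv τ ⟨hτ.1, hτ.2.trans_le ht.2⟩)
    (ContinuousOn.intervalIntegrable (by rwa [uIcc_of_le ht.1]))
  have hI : ‖∫ τ in (0 : ℝ)..t, v τ‖ ≤ S * |t - 0| := by
    refine intervalIntegral.norm_integral_le_of_norm_le_const fun σ hσ => ?_
    rw [uIoc_of_le ht.1] at hσ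
    exact hS σ ⟨hσ.1.le, hσ.2.trans ht.2⟩
  rw [e, sub_zero, abs_of_nonneg ht.1] at hI
  have : S * t ≤ T * S := by rw [mul_comm]; gcongr; exact ht.2
  linarith [norm_le_norm_add_norm_sub' (w t) (w 0)]

end Hilbert

/-! ### Multiplication by bounded functions -/

section Multiplication

variable {d : ℕ}

/-- Multiplication by a bounded real function, as a bounded operator on `L²`. -/
def mulOp (m : LInf d) : L2 d →L[ℂ] L2 d :=
  LinearMap.mkContinuous
    { toFun := fun v => (m • v : L2 d)
      map_add' := fun u v => Lp.add_smul m u v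
      map_smul' := fun c v => by
        refine Lp.ext ?_
        filter_upwards [Lp.coeFn_lpSMul (r := 2) m (c • v), Lp.coeFn_lpSMul (r := 2) m v,
          Lp.coeFn_smul c v, Lp.coeFn_smul c (m • v : L2 d)] with x h1 h2 h3 h4
        simp only [RingHom.id_apply, h1, h2, h3, h4, Pi.smul_apply, Pi.smul_apply']
        exact smul_comm _ _ _ }
    ‖m‖ (fun v => Lp.norm_smul_le m v)

theorem mulOp_apply (m : LInf d) (v : L2 d) : mulOp m v = (m • v : L2 d) := rfl

theorem norm_mulOp_apply_le (m : LInf d) (v : L2 d) : ‖mulOp m v‖ ≤ ‖m‖ * ‖v‖ :=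
  Lp.norm_smul_le m v

theorem coeFn_mulOp (m : LInf d) (v : L2 d) : mulOp m v =ᵐ[volume] fun x => m x • v x :=
  Lp.coeFn_lpSMul m v

theorem mulOp_sub (m m' : LInf d) (v : L2 d) : mulOp (m - m') v = mulOp m v - mulOp m' v := by
  simp only [mulOp_apply, sub_eq_add_neg, Lp.smul_add, Lp.neg_smul]

theorem inner_mulOp_left (m : LInf d) (u v : L2 d) :
    inner ℂ (mulOp m u) v = inner ℂ u (mulOp m v) := by
  rw [L2.inner_def, L2.inner_def]
  refine integral_congr_ae ?_
  filter_upwards [coeFn_mulOp m u, coeFn_mulOp m v] with x hu hv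
  simp [hu, hv, Complex.real_smul]
  ring

theorem re_inner_mulOp_nonneg {m : LInf d} (hm : ∀ᵐ x, 0 ≤ m x) (v : L2 d) :
    0 ≤ (inner ℂ v (mulOp m v)).re := by
  have h : (inner ℂ v (mulOp m v)).re = ∫ x, (inner ℂ (v x) (mulOp m v x)).re := by
    rw [L2.inner_def]
    exact (integral_re (𝕜 := ℂ) (L2.integrable_inner v (mulOp m v))).symm
  rw [h]
  refine integral_nonneg_of_ae ?_
  filter_upwards [hm, coeFn_mulOp m v] with x hx hv
  simp only [hv, Pi.zero_apply, Complex.real_smul, RCLike.inner_apply]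
  have : (m x : ℂ) * v x * (starRingEnd ℂ) (v x) = ((m x * Complex.normSq (v x) : ℝ) : ℂ) := by
    rw [mul_assoc, Complex.mul_conj]; push_cast; rfl
  rw [this, Complex.ofReal_re]
  exact mul_nonneg hx (Complex.normSq_nonneg _)

end Multiplication

/-! ### Truncation in frequency -/

section Truncation

variable {d : ℕ}

theorem norm_sq_eq_integral (v : L2 d) : ‖v‖ ^ 2 = ∫ ξ, ‖v ξ‖ ^ 2 := by
  have h := inner_self_eq_norm_sq (𝕜 := ℂ) v
  rw [← h, L2.inner_def]
  have : (fun a => inner ℂ (v a) (v a)) = fun a => ((‖v a‖ ^ 2 : ℝ) : ℂ) := by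
    ext a
    rw [inner_self_eq_norm_sq_to_K]
    push_cast; rfl
  rw [this, integral_complex_ofReal]
  simp

theorem integrable_norm_sq (v : L2 d) : Integrable (fun ξ => ‖v ξ‖ ^ 2) :=
  (memLp_two_iff_integrable_sq_norm (Lp.aestronglyMeasurable v)).1 (Lp.memLp v)

/-- The symbol `|ξ|^r 1_{‖ξ‖ ≤ n}`, where `|ξ|` reads `2π‖ξ‖` in Mathlib's normalisation of the
Fourier transform. As `0 ^ 0 = 1`, it is the indicator function of the ball for `r = 0`. -/
def truncSymbol (n : ℕ) (r : ℝ) (ξ : EuclideanSpace ℝ (Fin d)) : ℝ :=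
  if ‖ξ‖ ≤ n then (2 * Real.pi * ‖ξ‖) ^ r else 0

theorem measurable_rpow_norm (r : ℝ) :
    Measurable fun ξ : EuclideanSpace ℝ (Fin d) => (2 * Real.pi * ‖ξ‖) ^ r :=
  (measurable_const.mul measurable_norm).pow_const r

theorem measurable_truncSymbol (n : ℕ) (r : ℝ) :
    Measurable (truncSymbol n r : EuclideanSpace ℝ (Fin d) → ℝ) :=
  Measurable.ite (measurableSet_le measurable_norm measurable_const) (measurable_rpow_norm r)
    measurable_const

theorem truncSymbol_nonneg (n : ℕ) (r : ℝ) (ξ : EuclideanSpace ℝ (Fin d)) :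
    0 ≤ truncSymbol n r ξ := by
  unfold truncSymbol
  split_ifs <;> positivity

theorem truncSymbol_le {r : ℝ} (hr : 0 ≤ r) (n : ℕ) (ξ : EuclideanSpace ℝ (Fin d)) :
    truncSymbol n r ξ ≤ (2 * Real.pi * n) ^ r := by
  unfold truncSymbol
  split_ifs <;> [gcongr; positivity]

theorem truncSymbol_le_rpow (n : ℕ) (r : ℝ) (ξ : EuclideanSpace ℝ (Fin d)) :
    truncSymbol n r ξ ≤ (2 * Real.pi * ‖ξ‖) ^ r := by
  unfold truncSymbol
  split_ifs <;> [exact le_rfl; positivity]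

theorem truncSymbol_mul_zero (n : ℕ) (r : ℝ) (ξ : EuclideanSpace ℝ (Fin d)) :
    truncSymbol n r ξ * truncSymbol n 0 ξ = truncSymbol n r ξ := by
  unfold truncSymbol
  split_ifs <;> simp

theorem rpow_mul_truncSymbol_zero (n : ℕ) (r : ℝ) (ξ : EuclideanSpace ℝ (Fin d)) :
    (2 * Real.pi * ‖ξ‖) ^ r * truncSymbol n 0 ξ = truncSymbol n r ξ := by
  unfold truncSymbol
  split_ifs <;> simp

theorem memLp_truncSymbol (n : ℕ) {r : ℝ} (hr : 0 ≤ r) :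
    MemLp (truncSymbol n r : EuclideanSpace ℝ (Fin d) → ℝ) ∞ volume :=
  memLp_top_of_bound (measurable_truncSymbol n r).aestronglyMeasurable ((2 * Real.pi * n) ^ r)
    (Eventually.of_forall fun ξ => by
      rw [Real.norm_of_nonneg (truncSymbol_nonneg n r ξ)]
      exact truncSymbol_le hr n ξ)

/-- The Fourier multiplier with symbol `truncSymbol n r`: the truncation to the frequencies
`‖ξ‖ ≤ n` of `(-Δ)^{r/2}`, and the bare truncation for `r = 0`. It is set to `0` for `r < 0`, where
the symbol is unbounded. -/
def truncPow (n : ℕ) (r : ℝ) : L2 d →L[ℂ] L2 d :=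
  if hr : 0 ≤ r then
    (Lp.fourierTransformₗᵢ (EuclideanSpace ℝ (Fin d)) ℂ).symm.toContinuousLinearEquiv.toContinuousLinearMap ∘L
      mulOp (memLp_truncSymbol n hr).toLp ∘L
      (Lp.fourierTransformₗᵢ (EuclideanSpace ℝ (Fin d)) ℂ).toContinuousLinearEquiv.toContinuousLinearMap
  else 0

theorem truncPow_apply (n : ℕ) {r : ℝ} (hr : 0 ≤ r) (v : L2 d) :
    truncPow n r v = 𝓕⁻ (mulOp (memLp_truncSymbol n hr).toLp (𝓕 v : L2 d)) := by
  rw [truncPow, dif_pos hr]; rfl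

theorem fourier_truncPow (n : ℕ) {r : ℝ} (hr : 0 ≤ r) (v : L2 d) :
    (𝓕 (truncPow n r v) : L2 d) =ᵐ[volume] fun ξ => truncSymbol n r ξ • (𝓕 v : L2 d) ξ := by
  rw [truncPow_apply n hr, FourierTransform.fourier_fourierInv_eq]
  filter_upwards [coeFn_mulOp (memLp_truncSymbol n hr).toLp (𝓕 v : L2 d),
    (memLp_truncSymbol (d := d) n hr).coeFn_toLp] with ξ h1 h2
  rw [h1, h2]

theorem fourier_injective {u v : L2 d} (h : (𝓕 u : L2 d) =ᵐ[volume] (𝓕 v : L2 d)) : u = v :=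
  (Lp.fourierTransformₗᵢ (EuclideanSpace ℝ (Fin d)) ℂ).injective (Lp.ext h)

theorem inner_truncPow_left (n : ℕ) {r : ℝ} (hr : 0 ≤ r) (u v : L2 d) :
    inner ℂ (truncPow n r u) v = inner ℂ u (truncPow n r v) := by
  rw [← Lp.inner_fourier_eq, ← Lp.inner_fourier_eq u, truncPow_apply n hr, truncPow_apply n hr,
    FourierTransform.fourier_fourierInv_eq, FourierTransform.fourier_fourierInv_eq,
    inner_mulOp_left]

theorem truncPow_truncPow_zero (n : ℕ) {r : ℝ} (hr : 0 ≤ r) (v : L2 d) :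
    truncPow n r (truncPow n 0 v) = truncPow n r v := by
  apply fourier_injective
  filter_upwards [fourier_truncPow n hr (truncPow n 0 v), fourier_truncPow n hr v,
    fourier_truncPow n le_rfl v] with ξ h1 h2 h3
  rw [h1, h2, h3, smul_smul, truncSymbol_mul_zero]

theorem truncPow_zero_truncPow (n : ℕ) {r : ℝ} (hr : 0 ≤ r) (v : L2 d) :
    truncPow n 0 (truncPow n r v) = truncPow n r v := by
  apply fourier_injective
  filter_upwards [fourier_truncPow n le_rfl (truncPow n r v), fourier_truncPow n hr v]
    with ξ h1 h2
  rw [h1, h2, smul_smul, mul_comm, truncSymbol_mul_zero]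

theorem norm_truncPow_sq (n : ℕ) {r : ℝ} (hr : 0 ≤ r) (v : L2 d) :
    ‖truncPow n r v‖ ^ 2 = ∫ ξ, truncSymbol n r ξ ^ 2 * ‖(𝓕 v : L2 d) ξ‖ ^ 2 := by
  rw [← Lp.norm_fourier_eq, norm_sq_eq_integral]
  refine integral_congr_ae ?_
  filter_upwards [fourier_truncPow n hr v] with ξ h
  rw [h, norm_smul, mul_pow, Real.norm_eq_abs, sq_abs]

theorem norm_truncPow_zero_le (n : ℕ) (v : L2 d) : ‖truncPow n 0 v‖ ≤ ‖v‖ := by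
  rw [← sq_le_sq₀ (norm_nonneg _) (norm_nonneg _), norm_truncPow_sq n le_rfl,
    ← Lp.norm_fourier_eq v, norm_sq_eq_integral]
  refine integral_mono_of_nonneg (Eventually.of_forall fun ξ => by positivity)
    (integrable_norm_sq _) (Eventually.of_forall fun ξ => ?_)
  have h1 := truncSymbol_le (d := d) (le_refl 0) n ξ
  rw [Real.rpow_zero] at h1
  exact mul_le_of_le_one_left (by positivity) (pow_le_one₀ (truncSymbol_nonneg n 0 ξ) h1)

/-- The truncations converge strongly to the identity, by Plancherel and dominated convergence. -/
theorem tendsto_truncPow_zero (v : L2 d) :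
    Tendsto (fun n => truncPow n 0 v) atTop (𝓝 v) := by
  rw [tendsto_iff_norm_sub_tendsto_zero]
  have hsq : Tendsto (fun n => ‖truncPow n 0 v - v‖ ^ 2) atTop (𝓝 0) := by
    have e : ∀ n, ‖truncPow n 0 v - v‖ ^ 2 =
        ∫ ξ, (1 - truncSymbol n 0 ξ) ^ 2 * ‖(𝓕 v : L2 d) ξ‖ ^ 2 := by
      intro n
      rw [← Lp.norm_fourier_eq, norm_sq_eq_integral]
      refine integral_congr_ae ?_
      have : (𝓕 (truncPow n 0 v - v) : L2 d) = 𝓕 (truncPow n 0 v) - 𝓕 v :=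
        (Lp.fourierTransformₗᵢ (EuclideanSpace ℝ (Fin d)) ℂ).map_sub _ _
      rw [this]
      filter_upwards [fourier_truncPow n le_rfl v,
        Lp.coeFn_sub (𝓕 (truncPow n 0 v) : L2 d) (𝓕 v : L2 d)] with ξ h h'
      rw [h', Pi.sub_apply, h, norm_sub_rev]
      nth_rewrite 1 [← one_smul ℝ ((𝓕 v : L2 d) ξ)]
      rw [← sub_smul, norm_smul, mul_pow, Real.norm_eq_abs, sq_abs]
    simp only [e]
    have hz : ∫ _ : EuclideanSpace ℝ (Fin d), (0 : ℝ) = 0 := integral_zero _ _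
    suffices lim : Tendsto (fun n : ℕ => ∫ ξ, (1 - truncSymbol n 0 ξ) ^ 2 * ‖(𝓕 v : L2 d) ξ‖ ^ 2) atTop
        (𝓝 (∫ _ : EuclideanSpace ℝ (Fin d), (0 : ℝ))) by
      rwa [hz] at lim
    refine tendsto_integral_of_dominated_convergence (fun ξ => ‖(𝓕 v : L2 d) ξ‖ ^ 2)
      (fun n => ?_) (integrable_norm_sq _) (fun n => Eventually.of_forall fun ξ => ?_)
      (Eventually.of_forall fun ξ => ?_)
    · exact (((measurable_const.sub (measurable_truncSymbol n 0)).pow_const 2).aestronglyMeasurable).mul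
        (integrable_norm_sq _).aestronglyMeasurable
    · rw [Real.norm_of_nonneg (by positivity)]
      have h1 := truncSymbol_le (d := d) (le_refl 0) n ξ
      rw [Real.rpow_zero] at h1
      have h0 := truncSymbol_nonneg (d := d) n 0 ξ
      exact mul_le_of_le_one_left (by positivity) (pow_le_one₀ (by linarith) (by linarith))
    · refine tendsto_const_nhds.congr' ?_
      filter_upwards [eventually_ge_atTop ⌈‖ξ‖⌉₊] with n hn
      have : ‖ξ‖ ≤ n := (Nat.le_ceil _).trans (by exact_mod_cast hn)
      simp [truncSymbol, this]
  have := hsq.sqrt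
  simpa [Real.sqrt_sq] using this

end Truncation

/-! ### Truncation and the fractional Laplacian -/

section Sobolev

variable {d : ℕ} {s : ℝ}

theorem hsNorm_nonneg (v : L2 d) : 0 ≤ hsNorm s v := Real.sqrt_nonneg _

theorem hsNorm_sq (v : L2 d) : hsNorm s v ^ 2 = ∫ ξ : EuclideanSpace ℝ (Fin d),
    (1 + (2 * Real.pi * ‖ξ‖) ^ (2 * s)) * ‖(𝓕 v : L2 d) ξ‖ ^ 2 :=
  Real.sq_sqrt (integral_nonneg fun ξ => by positivity)

theorem norm_le_hsNorm {v : L2 d} (hv : MemHs s v) : ‖v‖ ≤ hsNorm s v := by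
  rw [← sq_le_sq₀ (norm_nonneg _) (hsNorm_nonneg v), hsNorm_sq, ← Lp.norm_fourier_eq v,
    norm_sq_eq_integral]
  refine integral_mono (integrable_norm_sq _) hv fun ξ => ?_
  exact le_mul_of_one_le_left (by positivity) (le_add_of_nonneg_right (by positivity))

theorem rpow_two_mul (s : ℝ) (ξ : EuclideanSpace ℝ (Fin d)) :
    (2 * Real.pi * ‖ξ‖) ^ (2 * s) = ((2 * Real.pi * ‖ξ‖) ^ s) ^ 2 := by
  rw [mul_comm 2 s, Real.rpow_mul (by positivity), Real.rpow_two]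

theorem norm_truncPow_le_hsNorm (hs : 0 ≤ s) {v : L2 d} (hv : MemHs s v) (n : ℕ) :
    ‖truncPow n s v‖ ≤ hsNorm s v := by
  rw [← sq_le_sq₀ (norm_nonneg _) (hsNorm_nonneg v), hsNorm_sq, norm_truncPow_sq n hs]
  refine integral_mono_of_nonneg (Eventually.of_forall fun ξ => by positivity) hv
    (Eventually.of_forall fun ξ => ?_)
  simp only [rpow_two_mul]
  have h0 := truncSymbol_nonneg n s ξ
  have h1 := truncSymbol_le_rpow n s ξ
  gcongr
  exact (pow_le_pow_left₀ h0 h1 2).trans (by linarith)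

theorem memHs_truncPow_zero (hs : 0 ≤ s) (n : ℕ) (v : L2 d) : MemHs s (truncPow n 0 v) := by
  have hmeas : AEStronglyMeasurable (fun ξ : EuclideanSpace ℝ (Fin d) =>
      (1 + (2 * Real.pi * ‖ξ‖) ^ (2 * s)) * ‖(𝓕 (truncPow n 0 v) : L2 d) ξ‖ ^ 2) volume :=
    (measurable_const.add (measurable_rpow_norm _)).aestronglyMeasurable.mul
      (integrable_norm_sq _).aestronglyMeasurable
  refine Integrable.mono' ((integrable_norm_sq (𝓕 v : L2 d)).const_mul
    (1 + ((2 * Real.pi * n) ^ s) ^ 2)) hmeas ?_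
  filter_upwards [fourier_truncPow n le_rfl v] with ξ h
  rw [Real.norm_of_nonneg (by positivity), h, norm_smul, mul_pow, ← mul_assoc, Real.norm_eq_abs,
    sq_abs, rpow_two_mul, add_mul, ← mul_pow, rpow_mul_truncSymbol_zero]
  have h0 := truncSymbol_nonneg n s ξ
  have h1 := truncSymbol_le hs n ξ
  have h2 := truncSymbol_le (le_refl 0) n ξ
  rw [Real.rpow_zero] at h2
  have h3 := pow_le_one₀ (n := 2) (truncSymbol_nonneg n 0 ξ) h2
  have h4 := pow_le_pow_left₀ h0 h1 2
  gcongr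
  linarith

theorem MemHs.memLp {v : L2 d} (hv : MemHs s v) :
    MemLp (fun ξ : EuclideanSpace ℝ (Fin d) =>
      (2 * Real.pi * ‖ξ‖) ^ (2 * (s / 2)) • (𝓕 v : L2 d) ξ) 2 volume := by
  have hm : AEStronglyMeasurable (fun ξ : EuclideanSpace ℝ (Fin d) =>
      (2 * Real.pi * ‖ξ‖) ^ (2 * (s / 2)) • (𝓕 v : L2 d) ξ) volume :=
    (measurable_rpow_norm _).aestronglyMeasurable.smul (Lp.aestronglyMeasurable _)
  rw [memLp_two_iff_integrable_sq_norm hm]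
  refine Integrable.mono' hv (hm.norm.pow 2) (Eventually.of_forall fun ξ => ?_)
  rw [Real.norm_of_nonneg (by positivity), norm_smul, mul_pow, Real.norm_eq_abs, sq_abs,
    mul_div_cancel₀ s (two_ne_zero), rpow_two_mul]
  gcongr
  linarith

theorem fourier_fracLaplacian {v : L2 d} (hv : MemHs s v) :
    (𝓕 (fracLaplacian (s / 2) v) : L2 d) =ᵐ[volume]
      fun ξ => (2 * Real.pi * ‖ξ‖) ^ s • (𝓕 v : L2 d) ξ := by
  rw [fracLaplacian, dif_pos hv.memLp, FourierTransform.fourier_fourierInv_eq]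
  filter_upwards [hv.memLp.coeFn_toLp] with ξ h
  rw [h, mul_div_cancel₀ s (two_ne_zero)]

theorem fracLaplacian_truncPow_zero (hs : 0 ≤ s) (n : ℕ) (v : L2 d) :
    fracLaplacian (s / 2) (truncPow n 0 v) = truncPow n s v := by
  apply fourier_injective
  filter_upwards [fourier_fracLaplacian (memHs_truncPow_zero hs n v), fourier_truncPow n hs v,
    fourier_truncPow n le_rfl v] with ξ h1 h2 h3
  rw [h1, h2, h3, smul_smul, rpow_mul_truncSymbol_zero]

theorem truncPow_zero_fracLaplacian (hs : 0 ≤ s) (n : ℕ) {v : L2 d} (hv : MemHs s v) :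
    truncPow n 0 (fracLaplacian (s / 2) v) = truncPow n s v := by
  apply fourier_injective
  filter_upwards [fourier_fracLaplacian hv, fourier_truncPow n hs v,
    fourier_truncPow n le_rfl (fracLaplacian (s / 2) v)] with ξ h1 h2 h3
  rw [h3, h1, h2, smul_smul, mul_comm, rpow_mul_truncSymbol_zero]

/-- Tested against a truncated function, the bilinear form of `(-Δ)ˢ` is given by bounded
operators. -/
theorem inner_fracLaplacian_truncPow (hs : 0 ≤ s) (n : ℕ) (φ : L2 d) {v : L2 d}
    (hv : MemHs s v) :
    inner ℂ (fracLaplacian (s / 2) (truncPow n 0 φ)) (fracLaplacian (s / 2) v) =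
      inner ℂ φ (truncPow n s (truncPow n s v)) := by
  rw [fracLaplacian_truncPow_zero hs, ← truncPow_zero_truncPow n hs φ,
    inner_truncPow_left n le_rfl, truncPow_zero_fracLaplacian hs n hv, inner_truncPow_left n hs]

end Sobolev

/-! ### Estimates for solutions of the Cauchy problem -/

section Solution

variable {d : ℕ} {T s : ℝ}

theorem MemHs.sub {u v : L2 d} (hu : MemHs s u) (hv : MemHs s v) : MemHs s (u - v) := by
  have hsub : (𝓕 (u - v) : L2 d) = 𝓕 u - 𝓕 v :=
    (Lp.fourierTransformₗᵢ (EuclideanSpace ℝ (Fin d)) ℂ).map_sub _ _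
  have hmeas : AEStronglyMeasurable (fun ξ : EuclideanSpace ℝ (Fin d) =>
      (1 + (2 * Real.pi * ‖ξ‖) ^ (2 * s)) * ‖(𝓕 (u - v) : L2 d) ξ‖ ^ 2) volume :=
    (measurable_const.add (measurable_rpow_norm _)).aestronglyMeasurable.mul
      (integrable_norm_sq _).aestronglyMeasurable
  refine Integrable.mono' ((Integrable.add hu hv).const_mul 2) hmeas ?_
  rw [hsub]
  filter_upwards [Lp.coeFn_sub (𝓕 u : L2 d) (𝓕 v : L2 d)] with ξ h
  rw [Real.norm_of_nonneg (by positivity), h, Pi.sub_apply, Pi.add_apply, ← mul_add,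
    mul_left_comm]
  gcongr
  have h1 := norm_sub_le ((𝓕 u : L2 d) ξ) ((𝓕 v : L2 d) ξ)
  calc ‖(𝓕 u : L2 d) ξ - (𝓕 v : L2 d) ξ‖ ^ 2
      ≤ (‖(𝓕 u : L2 d) ξ‖ + ‖(𝓕 v : L2 d) ξ‖) ^ 2 := by gcongr
    _ ≤ 2 * (‖(𝓕 u : L2 d) ξ‖ ^ 2 + ‖(𝓕 v : L2 d) ξ‖ ^ 2) := add_sq_le

theorem isTruncation_truncPow (hs : 0 ≤ s) :
    IsTruncation (H := L2 d) (fun n => truncPow n 0) (fun n => truncPow n s) where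
  symm_fst n := inner_truncPow_left n le_rfl
  symm_snd n := inner_truncPow_left n hs
  fst_fst n := truncPow_truncPow_zero n le_rfl
  snd_fst n := truncPow_truncPow_zero n hs
  norm_le n := norm_truncPow_zero_le n
  tendsto := tendsto_truncPow_zero

/-- Truncated functions lie in `Hˢ`, so that the equation may be tested against them. -/
theorem IsSolution.isTruncatedSolution {m b : LInf d} {f : ℝ → L2 d} {u₀ u₁ : L2 d}
    {u : ℝ → L2 d} (hT : 0 < T) (hs : 0 ≤ s) (hf : ContinuousOn f (Icc 0 T))
    (h : IsSolution T s m b f u₀ u₁ u) :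
    IsTruncatedSolution T (fun n => truncPow n 0) (fun n => truncPow n s) (mulOp m) (mulOp b)
      f u (dt T u) where
  contf := hf
  contw := h.contDiffOn.continuousOn
  contv := h.contDiffOn.continuousOn_derivWithin (uniqueDiffOn_Icc hT) le_rfl
  deriv t ht := by
    have hd := (h.contDiffOn.differentiableOn one_ne_zero t
      (Ioo_subset_Icc_self ht)).hasDerivWithinAt
    exact hd.hasDerivAt (Icc_mem_nhds ht.1 ht.2)
  eqn n φ t ht := by
    have ht' := Ioo_subset_Icc_self ht
    have hd := (h.equation (truncPow n 0 φ) (memHs_truncPow_zero hs n φ) t ht').hasDerivAt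
      (Icc_mem_nhds ht.1 ht.2)
    rw [inner_fracLaplacian_truncPow hs n φ (h.continuousHs.1 t ht')] at hd
    simp only [inner_truncPow_left n le_rfl] at hd
    refine hd.congr_deriv ?_
    simp only [map_sub, inner_sub_right, mulOp_apply]
    ring

/-- The a priori estimate, polynomial in the norms of the data and of the coefficients. -/
theorem IsTruncatedSolution.bounds {m b : LInf d} {f w v : ℝ → L2 d} (hs : 0 ≤ s)
    (h : IsTruncatedSolution T (fun n => truncPow n 0) (fun n => truncPow n s)
      (mulOp m) (mulOp b) f w v)
    (hm : ∀ᵐ x, 0 ≤ m x) (hb : ∀ᵐ x, 0 ≤ b x) (hw : MemHs s (w 0)) {F : ℝ}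
    (hF : ∀ t ∈ Icc 0 T, ‖f t‖ ≤ F) {t : ℝ} (ht : t ∈ Icc 0 T) :
    ‖v t‖ ≤ ‖v 0‖ + (1 + ‖m‖) * hsNorm s (w 0) + 2 * T * F ∧
    ‖w t‖ ≤ hsNorm s (w 0) + T * (‖v 0‖ + (1 + ‖m‖) * hsNorm s (w 0) + 2 * T * F) := by
  have hv : ∀ t ∈ Icc 0 T, ‖v t‖ ≤ ‖v 0‖ + (1 + ‖m‖) * hsNorm s (w 0) + 2 * T * F :=
    fun t ht => h.norm_deriv_le (isTruncation_truncPow hs) (inner_mulOp_left m)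
      (re_inner_mulOp_nonneg hm) (re_inner_mulOp_nonneg hb) (norm_truncPow_le_hsNorm hs hw)
      (norm_le_hsNorm hw) (norm_mulOp_apply_le m) (norm_nonneg m) hF ht
  refine ⟨hv t ht, (h.norm_le hv ht).trans ?_⟩
  gcongr
  exact norm_le_hsNorm hw

end Solution

/-! ### Moderate and negligible nets -/

section Nets

variable {T : ℝ} {p q : ℝ → ℝ}

theorem IsModerate.exists_nonneg (hp : IsModerate p) :
    ∃ (N : ℕ) (C : ℝ), 0 ≤ C ∧ ∀ ε ∈ Ioc (0 : ℝ) 1, p ε ≤ C * (ε ^ N)⁻¹ := by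
  obtain ⟨N, C, h⟩ := hp
  refine ⟨N, |C|, abs_nonneg C, fun ε hε => (h ε hε).trans ?_⟩
  have := hε.1
  gcongr
  exact le_abs_self C

theorem isModerate_const (c : ℝ) : IsModerate fun _ => c :=
  ⟨0, c, fun ε _ => by simp⟩

theorem IsModerate.add (hp : IsModerate p) (hq : IsModerate q) :
    IsModerate fun ε => p ε + q ε := by
  obtain ⟨N, C, hC, h⟩ := hp.exists_nonneg
  obtain ⟨N', C', hC', h'⟩ := hq.exists_nonneg
  refine ⟨N + N', C + C', fun ε hε => ?_⟩
  have h0 := hε.1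
  rw [add_mul]
  refine add_le_add ((h ε hε).trans ?_) ((h' ε hε).trans ?_)
  · exact mul_le_mul_of_nonneg_left (inv_anti₀ (by positivity)
      (pow_le_pow_of_le_one h0.le hε.2 (Nat.le_add_right _ _))) hC
  · exact mul_le_mul_of_nonneg_left (inv_anti₀ (by positivity)
      (pow_le_pow_of_le_one h0.le hε.2 (Nat.le_add_left _ _))) hC'

theorem IsModerate.mul (hp : IsModerate p) (hq : IsModerate q) (hq0 : ∀ ε, 0 ≤ q ε) :
    IsModerate fun ε => p ε * q ε := by
  obtain ⟨N, C, hC, h⟩ := hp.exists_nonneg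
  obtain ⟨N', C', hC', h'⟩ := hq.exists_nonneg
  refine ⟨N + N', C * C', fun ε hε => ?_⟩
  have h0 := hε.1
  calc p ε * q ε ≤ C * (ε ^ N)⁻¹ * (C' * (ε ^ N')⁻¹) :=
        mul_le_mul (h ε hε) (h' ε hε) (hq0 ε) (by positivity)
    _ = C * C' * (ε ^ (N + N'))⁻¹ := by rw [pow_add, mul_inv]; ring

theorem IsNegligible.add (hp : IsNegligible p) (hq : IsNegligible q) :
    IsNegligible fun ε => p ε + q ε := fun k => by
  obtain ⟨C, h⟩ := hp k
  obtain ⟨C', h'⟩ := hq k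
  exact ⟨C + C', fun ε hε => by rw [add_mul]; exact add_le_add (h ε hε) (h' ε hε)⟩

theorem IsModerate.mul_negligible (hp : IsModerate p) (hq : IsNegligible q)
    (hq0 : ∀ ε, 0 ≤ q ε) : IsNegligible fun ε => p ε * q ε := fun k => by
  obtain ⟨N, C, hC, h⟩ := hp.exists_nonneg
  obtain ⟨C', h'⟩ := hq (k + N)
  refine ⟨C * C', fun ε hε => ?_⟩
  have h0 := hε.1
  calc p ε * q ε ≤ C * (ε ^ N)⁻¹ * (C' * ε ^ (k + N)) :=
        mul_le_mul (h ε hε) (h' ε hε) (hq0 ε) (by positivity)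
    _ = C * C' * ε ^ k := by rw [pow_add]; field_simp

/-- The supremum over `t ∈ [0, T]` turns a uniform bound into a bound for a net of numbers. -/
theorem IsModerateUnif.exists_bound {r : ℝ → ℝ → ℝ} (hT : 0 ≤ T) (hr : IsModerateUnif T r)
    (hr0 : ∀ ε t, 0 ≤ r ε t) :
    ∃ ρ : ℝ → ℝ, IsModerate ρ ∧ (∀ ε, 0 ≤ ρ ε) ∧
      ∀ ε ∈ Ioc (0 : ℝ) 1, ∀ t ∈ Icc 0 T, r ε t ≤ ρ ε := by
  have hne : (Icc 0 T).Nonempty := nonempty_Icc.2 hT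
  obtain ⟨N, C, h⟩ := hr
  refine ⟨fun ε => sSup (r ε '' Icc 0 T), ⟨N, C, fun ε hε => ?_⟩, fun ε => ?_,
    fun ε hε t ht => ?_⟩
  · exact csSup_le (hne.image _) (forall_mem_image.2 (h ε hε))
  · exact Real.sSup_nonneg (forall_mem_image.2 fun t _ => hr0 ε t)
  · exact le_csSup ⟨_, forall_mem_image.2 (h ε hε)⟩ (mem_image_of_mem _ ht)

theorem IsNegligibleUnif.exists_bound {r : ℝ → ℝ → ℝ} (hT : 0 ≤ T) (hr : IsNegligibleUnif T r)
    (hr0 : ∀ ε t, 0 ≤ r ε t) :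
    ∃ ρ : ℝ → ℝ, IsNegligible ρ ∧ (∀ ε, 0 ≤ ρ ε) ∧
      ∀ ε ∈ Ioc (0 : ℝ) 1, ∀ t ∈ Icc 0 T, r ε t ≤ ρ ε := by
  have hne : (Icc 0 T).Nonempty := nonempty_Icc.2 hT
  refine ⟨fun ε => sSup (r ε '' Icc 0 T), fun k => ?_, fun ε => ?_, fun ε hε t ht => ?_⟩
  · obtain ⟨C, h⟩ := hr k
    exact ⟨C, fun ε hε => csSup_le (hne.image _) (forall_mem_image.2 (h ε hε))⟩
  · exact Real.sSup_nonneg (forall_mem_image.2 fun t _ => hr0 ε t)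
  · obtain ⟨C, h⟩ := hr 0
    exact le_csSup ⟨_, forall_mem_image.2 (h ε hε)⟩ (mem_image_of_mem _ ht)

end Nets

end VeryWeak

end

/-! ### Negligibility of the difference of the solutions -/

open VeryWeak in
theorem theorem4p11 (d : ℕ) (T s : ℝ) (hT : 0 < T) (hs : 0 < s)
    (R R' : VeryWeak.RegFamily d)
    (hR : R.Admissible T s) (hR' : R'.Admissible T s)
    (hneg : R.NegligibleDiff T s R')
    (u u' : ℝ → ℝ → VeryWeak.L2 d)
    (hu : R.SolvedBy T s u) (hu' : R'.SolvedBy T s u') :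
    VeryWeak.IsNegligibleUnif T (fun ε t => ‖u ε t - u' ε t‖) := by
  obtain ⟨φ, hφ, hφ0, hfφ⟩ := hR'.f_moderate.exists_bound hT.le fun _ _ => norm_nonneg _
  obtain ⟨ψ, hψ, hψ0, hfψ⟩ := hneg.f.exists_bound hT.le fun _ _ => norm_nonneg _
  -- Moderate bounds for `∂ₜu'` and `u'`.
  set V' : ℝ → ℝ := fun ε => ‖R'.u₁ ε‖ + (1 + ‖R'.m ε‖) * hsNorm s (R'.u₀ ε) + 2 * T * φ ε
  set U' : ℝ → ℝ := fun ε => hsNorm s (R'.u₀ ε) + T * V' ε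
  have hV'0 : ∀ ε, 0 ≤ V' ε := fun ε => by
    have := hsNorm_nonneg (s := s) (R'.u₀ ε)
    have := hφ0 ε
    positivity
  have hV'mod : IsModerate V' :=
    (hR'.u₁_moderate.add (((isModerate_const 1).add hR'.m_moderate).mul hR'.u₀_moderate
      fun ε => hsNorm_nonneg _)).add ((isModerate_const (2 * T)).mul hφ hφ0)
  have hU'mod : IsModerate U' := hR'.u₀_moderate.add ((isModerate_const T).mul hV'mod hV'0)
  have hbound' : ∀ ε ∈ Ioc (0 : ℝ) 1, ∀ t ∈ Icc 0 T, ‖dt T (u' ε) t‖ ≤ V' ε ∧ ‖u' ε t‖ ≤ U' ε := by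
    intro ε hε t ht
    have h := ((hu' ε hε).isTruncatedSolution hT hs.le (hR'.f_cont ε hε)).bounds hs.le
      (hR'.m_nonneg ε hε) (hR'.b_nonneg ε hε)
      (by rw [(hu' ε hε).init]; exact hR'.u₀_mem ε hε) (hfφ ε hε) ht
    rwa [(hu' ε hε).init, (hu' ε hε).init_dt] at h
  -- Negligible bounds for the source of the equation of `u - u'`, and for `∂ₜ(u - u')`.
  set F : ℝ → ℝ := fun ε => ψ ε + U' ε * ‖R.m ε - R'.m ε‖ + V' ε * ‖R.b ε - R'.b ε‖
  set V : ℝ → ℝ := fun ε => ‖R.u₁ ε - R'.u₁ ε‖ +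
    (1 + ‖R.m ε‖) * hsNorm s (R.u₀ ε - R'.u₀ ε) + 2 * T * F ε
  have hF0 : ∀ ε, 0 ≤ F ε := fun ε => by
    have := hsNorm_nonneg (s := s) (R'.u₀ ε)
    have := hψ0 ε
    have := hV'0 ε
    positivity
  have hV0 : ∀ ε, 0 ≤ V ε := fun ε => by
    have := hsNorm_nonneg (s := s) (R.u₀ ε - R'.u₀ ε)
    have := hF0 ε
    positivity
  have hFneg : IsNegligible F :=
    (hψ.add (hU'mod.mul_negligible hneg.m fun ε => norm_nonneg _)).add
      (hV'mod.mul_negligible hneg.b fun ε => norm_nonneg _)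
  have hVneg : IsNegligible V :=
    (hneg.u₁.add (((isModerate_const 1).add hR.m_moderate).mul_negligible hneg.u₀
      fun ε => hsNorm_nonneg _)).add ((isModerate_const (2 * T)).mul_negligible hFneg hF0)
  have hUneg := hneg.u₀.add ((isModerate_const T).mul_negligible hVneg hV0)
  intro k
  obtain ⟨C, hC⟩ := hUneg k
  refine ⟨C, fun ε hε t ht => le_trans ?_ (hC ε hε)⟩
  have h := (((hu ε hε).isTruncatedSolution hT hs.le (hR.f_cont ε hε)).sub
    ((hu' ε hε).isTruncatedSolution hT hs.le (hR'.f_cont ε hε))).bounds hs.le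
      (hR.m_nonneg ε hε) (hR.b_nonneg ε hε)
      (by rw [(hu ε hε).init, (hu' ε hε).init]; exact (hR.u₀_mem ε hε).sub (hR'.u₀_mem ε hε))
      (F := F ε) (fun τ hτ => ?_) ht
  · rw [(hu ε hε).init, (hu' ε hε).init, (hu ε hε).init_dt, (hu' ε hε).init_dt] at h
    exact h.2
  · simp only [sub_apply, ← mulOp_sub]
    obtain ⟨h1, h2⟩ := hbound' ε hε τ hτ
    refine (norm_sub_le _ _).trans (add_le_add ((norm_sub_le _ _).trans
      (add_le_add (hfψ ε hε τ hτ) ?_)) ?_)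
    · rw [mul_comm]
      exact (norm_mulOp_apply_le _ _).trans (by gcongr)
    · rw [mul_comm]
      exact (norm_mulOp_apply_le _ _).trans (by gcongr)
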